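/- All distributive lattices are bounded and sublattices contain $0$ and $1$. Locales are identified with their frames; a locale map $f:X\to Y$ is given by a frame homomorphism $f^{*}:Y\to X$ (its inverse image), whose right adjoint $f_{*}:X\to Y$ is its direct image. A distributive lattice $D$ is *normal* if whenever $a\vee b=1$ there are $c,d\in D$ with $c\vee a=b\vee d=1$ and $c\wedge d=0$. It is *conjunctive* if, for all $a,b\in D$, whenever every $c\in D$ with $a\vee c=1$ satisfies $b\vee c=1$, one has $a\le b$. A sublattice $B$ of a frame $A$ is a *base* for $A$ if every element of $A$ is a join of elements of $B$. It is *$A$-conjunctive* if for all $a\in A$ and $b\in B$: if for every $c\in B$ with $c\vee b=1$ there is $d\in B$ with $d\le a$ and $c\vee d=1$, then $b\le a$. For a distributive lattice $D$, the *maximal topology* $J_m^{D}$ is the Grothendieck topology on $D$ in which the sieve generated by $\{c_i\le c\mid i\in I\}$ covers $c$ iff for every $d\in D$ with $c\vee d=1$ there is a finite $F\subseteq I$ with $\bigvee_{i\in F}c_i\vee d=1$. $\mathrm{Id}_{J_m^{D}}(D)$ is the frame of $J_m^{D}$-ideals, that is of the lower sets of $D$ containing every element that they cover. For a locale $A$,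 write $a\prec b$ if there is $c\in A$ with $c\wedge a=0$ and $c\vee b=1$, and $a\prec\!\!\prec b$ if there is a family $(u_q)_{q\in\mathbb{Q}\cap[0,1]}$ in $A$ with $u_0=a$, $u_1=b$ and $u_p\prec u_q$ whenever $p<q$. The locale $A$ is *completely regular* if each $a\in A$ is the join of the elements $b\prec\!\!\prec a$. The Stone–Čech compactification $\eta_A:A\to\beta(A)$ is the locale of completely regular ideals of $A$ (ideals $I$ such that for each $x\in I$ there is $y\in I$ with $x\prec\!\!\prec y$), with $\eta_A^{*}(I)=\bigvee I$. **Theorem.** Assume the axiom of dependent choices. Let $A$ be a locale and $B$ a normal sublattice of $A$. There is a (necessarily unique) locale map $g:A\to \mathrm{Id}_{J_m^{B}}(B)$ whose direct image sends each $a\in A$ to the $J_m^{B}$-closure of the ideal $\{b\in B\mid b\le a\}$, and there is a unique locale map $h:\beta(A)\to \mathrm{Id}_{J_m^{B}}(B)$ with $h\circ\eta_A=g$. Moreover: 1. If $B$ is conjunctive, then $h$ is an isomorphism if and only if the direct image $(\eta_A)_{*}$ is injective on $B$ and $(\eta_A)_{*}(B)$ is a $\beta(A)$-conjunctive base for $\beta(A)$,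 i.e. a sublattice of $\beta(A)$ which is a base for $\beta(A)$ and is $\beta(A)$-conjunctive. 2. In particular, if $A$ is completely regular and $B$ is a conjunctive (normal) base for $A$, then $h$ is an isomorphism if and only if $(\eta_A)_{*}(B)$ is a $\beta(A)$-conjunctive base for $\beta(A)$. 3. The hypotheses of 2 hold if $B$ is a (normal) $A$-conjunctive base for $A$: then $A$ is completely regular and $B$ is conjunctive, so that the equivalence in 2 holds. -/

import Mathlib

/-! ### Locale maps

A locale is given by its frame. A locale map `X → Y` is a frame homomorphism from the frame of `Y`
to the frame of `X`, its inverse image. -/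

/-- Locale maps `X → Y`, represented by their inverse images. -/
abbrev LocaleMap (X Y : Type*) [Order.Frame X] [Order.Frame Y] := FrameHom Y X

namespace LocaleMap

variable {X Y Z : Type*} [Order.Frame X] [Order.Frame Y] [Order.Frame Z]

/-- The composite `X → Y → Z` of two locale maps. -/
def compose (k : LocaleMap Y Z) (f : LocaleMap X Y) : LocaleMap X Z := FrameHom.comp f k

/-- The direct image of a locale map, that is the right adjoint of its inverse image. -/
def direct (f : LocaleMap X Y) (x : X) : Y := sSup {y : Y | f y ≤ x}

theorem gc (f : LocaleMap X Y) : GaloisConnection f (direct f) := by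
  intro y x
  constructor
  · intro h
    exact le_sSup h
  · intro h
    refine (OrderHomClass.mono f h).trans ?_
    rw [direct, map_sSup]
    apply sSup_le
    rintro _ ⟨y', hy', rfl⟩
    exact hy'

/-- A locale map is an isomorphism if it has a two-sided inverse locale map. -/
def IsIso (f : LocaleMap X Y) : Prop :=
  ∃ k : LocaleMap Y X, compose k f = FrameHom.id X ∧ compose f k = FrameHom.id Y

end LocaleMap

/-! ### Sublattices of a frame, normality, conjunctivity -/

/-- A sublattice containing `⊥` and `⊤`. -/
structure BoundedSublattice (A : Type*) [Lattice A] [BoundedOrder A] extends Sublattice A where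
  bot_mem : ⊥ ∈ carrier
  top_mem : ⊤ ∈ carrier

namespace BoundedSublattice

/-- The underlying type of a bounded sublattice. -/
abbrev Elem {A : Type*} [Lattice A] [BoundedOrder A] (B : BoundedSublattice A) : Type _ :=
  B.toSublattice

instance instBoundedOrderElem {A : Type*} [Lattice A] [BoundedOrder A] (B : BoundedSublattice A) :
    BoundedOrder B.Elem where
  top := ⟨⊤, B.top_mem⟩
  le_top x := show (x : A) ≤ ⊤ from le_top
  bot := ⟨⊥, B.bot_mem⟩
  bot_le x := show ⊥ ≤ (x : A) from bot_le

end BoundedSublattice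

/-- Normality of a distributive lattice with `0` and `1`. -/
def IsNormalLattice (D : Type*) [DistribLattice D] [BoundedOrder D] : Prop :=
  ∀ a b : D, a ⊔ b = ⊤ → ∃ c d : D, c ⊔ a = ⊤ ∧ b ⊔ d = ⊤ ∧ c ⊓ d = ⊥

/-- Conjunctivity of a distributive lattice with `0` and `1`. -/
def IsConjunctiveLattice (D : Type*) [DistribLattice D] [BoundedOrder D] : Prop :=
  ∀ a b : D, (∀ c : D, a ⊔ c = ⊤ → b ⊔ c = ⊤) → a ≤ b

namespace BoundedSublattice

variable {A : Type*} [Order.Frame A]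

/-- `B` is a base for the frame `A`: every element of `A` is a join of elements of `B`. -/
def IsBase (B : BoundedSublattice A) : Prop :=
  ∀ a : A, ∃ T : Set A, T ⊆ B.carrier ∧ sSup T = a

/-- `B` is `A`-conjunctive. -/
def IsConjunctiveIn (B : BoundedSublattice A) : Prop :=
  ∀ a : A, ∀ b ∈ B.carrier,
    (∀ c ∈ B.carrier, c ⊔ b = ⊤ → ∃ d ∈ B.carrier, d ≤ a ∧ c ⊔ d = ⊤) → b ≤ a

end BoundedSublattice

/-- A subset `S` of a frame `K` is a `K`-conjunctive base for `K`: it is (the underlying set of) a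
sublattice of `K` which is a base for `K` and is `K`-conjunctive. -/
def IsConjunctiveBase {K : Type*} [Order.Frame K] (S : Set K) : Prop :=
  ∃ C : BoundedSublattice K, C.carrier = S ∧ C.IsBase ∧ C.IsConjunctiveIn

/-! ### The maximal topology and its frame of ideals -/

section MaximalTopology

variable {D : Type*} [DistribLattice D] [BoundedOrder D]

/-- The family `S` of elements below `c` generates a covering sieve on `c` for the maximal
topology on `D`. -/
def MaximalCover (S : Set D) (c : D) : Prop :=
  (∀ s ∈ S, s ≤ c) ∧
    ∀ d : D, c ⊔ d = ⊤ → ∃ F : Finset D, (F : Set D) ⊆ S ∧ F.sup id ⊔ d = ⊤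

variable (D) in
/-- The ideals of `D` for the maximal topology: lower sets which contain every element that they
cover. -/
@[ext]
structure MaxIdeal where
  carrier : Set D
  lower : ∀ x ∈ carrier, ∀ y : D, y ≤ x → y ∈ carrier
  covered : ∀ (c : D) (S : Set D), MaximalCover S c → S ⊆ carrier → c ∈ carrier

namespace MaxIdeal

instance : PartialOrder (MaxIdeal D) where
  le I J := I.carrier ⊆ J.carrier
  le_refl I := Set.Subset.refl I.carrier
  le_trans _ _ _ h h' := Set.Subset.trans h h'
  le_antisymm _ _ h h' := MaxIdeal.ext (Set.Subset.antisymm h h')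

theorem le_def {I J : MaxIdeal D} : I ≤ J ↔ I.carrier ⊆ J.carrier := Iff.rfl

/-- If every element of `F` is covered by `S` (relatively to tops), then `F` may be replaced by a
finite part of `S`. -/
theorem refine_cover {S T : Set D}
    (h : ∀ t ∈ T, ∀ d : D, t ⊔ d = ⊤ → ∃ F : Finset D, (F : Set D) ⊆ S ∧ F.sup id ⊔ d = ⊤)
    (G : Finset D) : (G : Set D) ⊆ T → ∀ d : D, G.sup id ⊔ d = ⊤ →
      ∃ F : Finset D, (F : Set D) ⊆ S ∧ F.sup id ⊔ d = ⊤ := by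
  classical
  induction G using Finset.induction_on with
  | empty =>
    intro _ d hd
    exact ⟨∅, by simp, hd⟩
  | insert a G _ ih =>
    intro hG d hd
    rw [Finset.coe_insert, Set.insert_subset_iff] at hG
    rw [Finset.sup_insert, id, sup_assoc] at hd
    obtain ⟨F, hF, hFd⟩ := h a hG.1 _ hd
    rw [sup_left_comm] at hFd
    obtain ⟨F', hF', hFd'⟩ := ih hG.2 _ hFd
    refine ⟨F' ∪ F, ?_, ?_⟩
    · rw [Finset.coe_union]
      exact Set.union_subset hF' hF
    · rw [Finset.sup_union, sup_assoc]
      exact hFd'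

/-- The closure of a subset of `D` for the maximal topology, see `closure_le_iff`. -/
def closure (S : Set D) : MaxIdeal D where
  carrier := {x : D | ∀ d : D, x ⊔ d = ⊤ → ∃ F : Finset D, (F : Set D) ⊆ S ∧ F.sup id ⊔ d = ⊤}
  lower x hx y hyx d hd := hx d (top_le_iff.1 (hd ▸ sup_le_sup_right hyx d))
  covered c T hT hTS d hd := by
    obtain ⟨G, hG, hGd⟩ := hT.2 d hd
    exact refine_cover (S := S) (T := T) (fun t ht => hTS ht) G hG d hGd

theorem mem_closure {S : Set D} {x : D} : x ∈ (closure S).carrier ↔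
    ∀ d : D, x ⊔ d = ⊤ → ∃ F : Finset D, (F : Set D) ⊆ S ∧ F.sup id ⊔ d = ⊤ := Iff.rfl

theorem subset_closure (S : Set D) : S ⊆ (closure S).carrier := by
  intro x hx d hd
  exact ⟨{x}, by simpa using hx, by simpa using hd⟩

/-- `closure S` is the smallest ideal for the maximal topology that contains `S`. -/
theorem closure_le_iff {S : Set D} {I : MaxIdeal D} : closure S ≤ I ↔ S ⊆ I.carrier := by
  classical
  constructor
  · intro h
    exact (subset_closure S).trans h
  · intro h x hx
    refine I.covered x {y | y ≤ x ∧ ∃ s ∈ S, y ≤ s} ⟨fun s hs => hs.1, ?_⟩ ?_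
    · intro d hd
      obtain ⟨F, hF, hFd⟩ := hx d hd
      refine ⟨F.image (fun s => x ⊓ s), ?_, ?_⟩
      · intro y hy
        rw [Finset.mem_coe, Finset.mem_image] at hy
        obtain ⟨s, hs, rfl⟩ := hy
        exact ⟨inf_le_left, s, hF hs, inf_le_right⟩
      · have h1 : (F.image (fun s => x ⊓ s)).sup id = x ⊓ F.sup id := by
          rw [Finset.sup_image, Finset.sup_inf_distrib_left]
          rfl
        rw [h1, sup_inf_right, hd, hFd, inf_top_eq]
    · rintro y ⟨_, s, hs, hys⟩
      exact I.lower s (h hs) y hys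

/-- Joins of ideals: the closure of the union. -/
instance : SupSet (MaxIdeal D) where
  sSup 𝓢 := closure (⋃ I ∈ 𝓢, I.carrier)

theorem isLUB_sSup (𝓢 : Set (MaxIdeal D)) : IsLUB 𝓢 (sSup 𝓢) := by
  constructor
  · intro I hI
    exact (Set.subset_biUnion_of_mem (u := fun I : MaxIdeal D => I.carrier) hI).trans
      (subset_closure _)
  · intro J hJ
    refine closure_le_iff.2 ?_
    exact Set.iUnion₂_subset fun I hI => hJ hI

/-- Binary meets of ideals: the intersection. -/
def inter (I J : MaxIdeal D) : MaxIdeal D where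
  carrier := I.carrier ∩ J.carrier
  lower x hx y hyx := ⟨I.lower x hx.1 y hyx, J.lower x hx.2 y hyx⟩
  covered c S hS hSI := ⟨I.covered c S hS (hSI.trans Set.inter_subset_left),
    J.covered c S hS (hSI.trans Set.inter_subset_right)⟩

instance : CompleteLattice (MaxIdeal D) where
  __ := completeLatticeOfSup (MaxIdeal D) isLUB_sSup
  inf := inter
  inf_le_left _ _ := Set.inter_subset_left
  inf_le_right _ _ := Set.inter_subset_right
  le_inf _ _ _ h h' := Set.subset_inter h h'

theorem carrier_inf (I J : MaxIdeal D) : (I ⊓ J).carrier = I.carrier ∩ J.carrier := rfl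

theorem carrier_sSup (𝓢 : Set (MaxIdeal D)) :
    (sSup 𝓢).carrier = (closure (⋃ I ∈ 𝓢, I.carrier)).carrier := rfl

theorem inf_sSup_le (I : MaxIdeal D) (𝓢 : Set (MaxIdeal D)) :
    I ⊓ sSup 𝓢 ≤ ⨆ J ∈ 𝓢, I ⊓ J := by
  classical
  rintro x ⟨hxI, hx⟩
  have key : x ∈ (closure (⋃ J ∈ 𝓢, (I ⊓ J).carrier)).carrier := by
    intro d hd
    obtain ⟨F, hF, hFd⟩ := hx d hd
    refine ⟨F.image (fun s => x ⊓ s), ?_, ?_⟩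
    · intro y hy
      rw [Finset.mem_coe, Finset.mem_image] at hy
      obtain ⟨s, hs, rfl⟩ := hy
      obtain ⟨J, hJ, hsJ⟩ := Set.mem_iUnion₂.1 (hF hs)
      exact Set.mem_iUnion₂.2
        ⟨J, hJ, I.lower x hxI _ inf_le_left, J.lower s hsJ _ inf_le_right⟩
    · have h1 : (F.image (fun s => x ⊓ s)).sup id = x ⊓ F.sup id := by
        rw [Finset.sup_image, Finset.sup_inf_distrib_left]
        rfl
      rw [h1, sup_inf_right, hd, hFd, inf_top_eq]
  refine (closure_le_iff.2 ?_ : closure (⋃ J ∈ 𝓢, (I ⊓ J).carrier) ≤ ⨆ J ∈ 𝓢, I ⊓ J) key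
  exact Set.iUnion₂_subset fun J hJ => le_def.1 (le_iSup₂ (f := fun J _ => I ⊓ J) J hJ)

/-- The frame of ideals of `D` for the maximal topology. -/
instance : Order.Frame (MaxIdeal D) := Order.Frame.ofMinimalAxioms ⟨inf_sSup_le⟩

end MaxIdeal

end MaximalTopology

/-- The function sending `a ∈ A` to the closure, for the maximal topology on `B`, of the ideal
`{b ∈ B | b ≤ a}`. -/
def wallmanDirect {A : Type*} [Order.Frame A] (B : BoundedSublattice A) (a : A) :
    MaxIdeal B.Elem :=
  MaxIdeal.closure {b : B.Elem | (b : A) ≤ a}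

/-! ### Completely regular locales and the Stone–Čech compactification -/

section StoneCech

variable {A : Type*} [Order.Frame A]

/-- `a` is well inside `b`. -/
def WellInside (a b : A) : Prop := ∃ c : A, c ⊓ a = ⊥ ∧ c ⊔ b = ⊤

/-- `a` is completely below (really inside) `b`: there is a scale from `a` to `b` indexed by the
rationals in `[0, 1]`. -/
def CompletelyBelow (a b : A) : Prop :=
  ∃ u : ℚ → A, u 0 = a ∧ u 1 = b ∧ ∀ p q : ℚ, 0 ≤ p → p < q → q ≤ 1 → WellInside (u p) (u q)

variable (A) in
/-- Completely regular locales. -/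
def IsCompletelyRegularLocale : Prop :=
  ∀ a : A, IsLUB {b : A | CompletelyBelow b a} a

theorem WellInside.le {a b : A} (h : WellInside a b) : a ≤ b := by
  obtain ⟨c, h0, h1⟩ := h
  calc a = a ⊓ (c ⊔ b) := by rw [h1, inf_top_eq]
    _ = (c ⊓ a) ⊔ (a ⊓ b) := by rw [inf_sup_left, inf_comm a c]
    _ ≤ b := by rw [h0, bot_sup_eq]; exact inf_le_right

theorem WellInside.sup {a b a' b' : A} (h : WellInside a b) (h' : WellInside a' b') :
    WellInside (a ⊔ a') (b ⊔ b') := by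
  obtain ⟨c, h0, h1⟩ := h
  obtain ⟨c', h0', h1'⟩ := h'
  refine ⟨c ⊓ c', ?_, ?_⟩
  · rw [inf_sup_left, inf_right_comm, h0, bot_inf_eq, bot_sup_eq, inf_assoc, h0', inf_bot_eq]
  · rw [sup_inf_right, ← sup_assoc, h1, top_sup_eq, sup_left_comm, h1', sup_top_eq, inf_top_eq]

theorem WellInside.inf {a b a' b' : A} (h : WellInside a b) (h' : WellInside a' b') :
    WellInside (a ⊓ a') (b ⊓ b') := by
  obtain ⟨c, h0, h1⟩ := h
  obtain ⟨c', h0', h1'⟩ := h'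
  refine ⟨c ⊔ c', ?_, ?_⟩
  · rw [inf_sup_right, ← inf_assoc, h0, bot_inf_eq, inf_left_comm, h0', inf_bot_eq, sup_bot_eq]
  · rw [sup_inf_left, sup_right_comm, h1, top_sup_eq, sup_assoc, h1', sup_top_eq, inf_top_eq]

theorem CompletelyBelow.le {a b : A} (h : CompletelyBelow a b) : a ≤ b := by
  obtain ⟨u, h0, h1, hu⟩ := h
  have := (hu 0 1 le_rfl zero_lt_one le_rfl).le
  rwa [h0, h1] at this

theorem CompletelyBelow.sup {a b a' b' : A} (h : CompletelyBelow a b)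
    (h' : CompletelyBelow a' b') : CompletelyBelow (a ⊔ a') (b ⊔ b') := by
  obtain ⟨u, h0, h1, hu⟩ := h
  obtain ⟨u', h0', h1', hu'⟩ := h'
  exact ⟨fun q => u q ⊔ u' q, by simp only [h0, h0'], by simp only [h1, h1'],
    fun p q hp hpq hq => (hu p q hp hpq hq).sup (hu' p q hp hpq hq)⟩

theorem CompletelyBelow.inf {a b a' b' : A} (h : CompletelyBelow a b)
    (h' : CompletelyBelow a' b') : CompletelyBelow (a ⊓ a') (b ⊓ b') := by
  obtain ⟨u, h0, h1, hu⟩ := h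
  obtain ⟨u', h0', h1', hu'⟩ := h'
  exact ⟨fun q => u q ⊓ u' q, by simp only [h0, h0'], by simp only [h1, h1'],
    fun p q hp hpq hq => (hu p q hp hpq hq).inf (hu' p q hp hpq hq)⟩

theorem CompletelyBelow.bot : CompletelyBelow (⊥ : A) ⊥ :=
  ⟨fun _ => ⊥, rfl, rfl, fun _ _ _ _ _ => ⟨⊤, inf_bot_eq _, top_sup_eq _⟩⟩

theorem CompletelyBelow.top : CompletelyBelow (⊤ : A) ⊤ :=
  ⟨fun _ => ⊤, rfl, rfl, fun _ _ _ _ _ => ⟨⊥, bot_inf_eq _, sup_top_eq _⟩⟩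

theorem CompletelyBelow.mono_left {a b c : A} (hab : a ≤ b) (h : CompletelyBelow b c) :
    CompletelyBelow a c := by
  obtain ⟨u, h0, h1, hu⟩ := h
  refine ⟨fun q => if q = 0 then a else u q, by simp, by simp [h1], ?_⟩
  intro p q hp hpq hq
  have hq0 : q ≠ 0 := (hp.trans_lt hpq).ne'
  obtain ⟨c, hc0, hc1⟩ := hu p q hp hpq hq
  refine ⟨c, ?_, by simpa [hq0] using hc1⟩
  by_cases hp0 : p = 0
  · subst hp0
    rw [h0] at hc0
    simp only [if_true]
    exact le_bot_iff.1 (hc0 ▸ inf_le_inf_left c hab)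
  · simpa [hp0] using hc0

variable (A) in
/-- The completely regular ideals of `A`. As a locale, this is the Stone–Čech compactification
of `A`. -/
@[ext]
structure StoneCechLocale where
  carrier : Set A
  bot_mem : ⊥ ∈ carrier
  lower : ∀ x ∈ carrier, ∀ y : A, y ≤ x → y ∈ carrier
  sup_mem : ∀ x ∈ carrier, ∀ y ∈ carrier, x ⊔ y ∈ carrier
  completelyRegular : ∀ x ∈ carrier, ∃ y ∈ carrier, CompletelyBelow x y

namespace StoneCechLocale

instance : PartialOrder (StoneCechLocale A) where
  le I J := I.carrier ⊆ J.carrier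
  le_refl I := Set.Subset.refl I.carrier
  le_trans _ _ _ h h' := Set.Subset.trans h h'
  le_antisymm _ _ h h' := StoneCechLocale.ext (Set.Subset.antisymm h h')

theorem le_def {I J : StoneCechLocale A} : I ≤ J ↔ I.carrier ⊆ J.carrier := Iff.rfl

theorem finset_sup_mem (I : StoneCechLocale A) (F : Finset A) (hF : (F : Set A) ⊆ I.carrier) :
    F.sup id ∈ I.carrier :=
  Finset.sup_induction I.bot_mem I.sup_mem fun _ hx => hF hx

/-- Joins of completely regular ideals: the ideal generated by the union. -/
instance : SupSet (StoneCechLocale A) where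
  sSup 𝓢 :=
    { carrier := {x : A | ∃ F : Finset A, (F : Set A) ⊆ ⋃ I ∈ 𝓢, I.carrier ∧ x ≤ F.sup id}
      bot_mem := ⟨∅, by simp, bot_le⟩
      lower := fun _ ⟨F, hF, hx⟩ _ hyx => ⟨F, hF, hyx.trans hx⟩
      sup_mem := by
        classical
        rintro x ⟨F, hF, hx⟩ y ⟨G, hG, hy⟩
        refine ⟨F ∪ G, ?_, ?_⟩
        · rw [Finset.coe_union]
          exact Set.union_subset hF hG
        · rw [Finset.sup_union]
          exact sup_le_sup hx hy
      completelyRegular := by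
        classical
        rintro x ⟨F, hF, hx⟩
        have key : ∀ F : Finset A, (F : Set A) ⊆ ⋃ I ∈ 𝓢, I.carrier →
            ∃ G : Finset A, (G : Set A) ⊆ ⋃ I ∈ 𝓢, I.carrier ∧
              CompletelyBelow (F.sup id) (G.sup id) := by
          intro F
          induction F using Finset.induction_on with
          | empty => exact fun _ => ⟨∅, by simp, by simpa using CompletelyBelow.bot⟩
          | insert a F _ ih =>
            intro hF
            rw [Finset.coe_insert, Set.insert_subset_iff] at hF
            obtain ⟨G, hG, hFG⟩ := ih hF.2
            obtain ⟨I, hI, haI⟩ := Set.mem_iUnion₂.1 hF.1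
            obtain ⟨b, hb, hab⟩ := I.completelyRegular a haI
            refine ⟨insert b G, ?_, ?_⟩
            · rw [Finset.coe_insert, Set.insert_subset_iff]
              exact ⟨Set.mem_iUnion₂.2 ⟨I, hI, hb⟩, hG⟩
            · rw [Finset.sup_insert, Finset.sup_insert]
              exact hab.sup hFG
        obtain ⟨G, hG, hFG⟩ := key F hF
        exact ⟨G.sup id, ⟨G, hG, le_rfl⟩, hFG.mono_left hx⟩ }

theorem mem_sSup {𝓢 : Set (StoneCechLocale A)} {x : A} : x ∈ (sSup 𝓢).carrier ↔
    ∃ F : Finset A, (F : Set A) ⊆ ⋃ I ∈ 𝓢, I.carrier ∧ x ≤ F.sup id := Iff.rfl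

theorem isLUB_sSup (𝓢 : Set (StoneCechLocale A)) : IsLUB 𝓢 (sSup 𝓢) := by
  constructor
  · intro I hI x hx
    exact ⟨{x}, by simpa using ⟨I, hI, hx⟩, by simp⟩
  · rintro J hJ x ⟨F, hF, hx⟩
    refine J.lower _ (J.finset_sup_mem F (hF.trans ?_)) x hx
    exact Set.iUnion₂_subset fun I hI => hJ hI

/-- Binary meets of completely regular ideals: the intersection. -/
def inter (I J : StoneCechLocale A) : StoneCechLocale A where
  carrier := I.carrier ∩ J.carrier
  bot_mem := ⟨I.bot_mem, J.bot_mem⟩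
  lower x hx y hyx := ⟨I.lower x hx.1 y hyx, J.lower x hx.2 y hyx⟩
  sup_mem x hx y hy := ⟨I.sup_mem x hx.1 y hy.1, J.sup_mem x hx.2 y hy.2⟩
  completelyRegular x hx := by
    obtain ⟨y, hy, hxy⟩ := I.completelyRegular x hx.1
    obtain ⟨z, hz, hxz⟩ := J.completelyRegular x hx.2
    refine ⟨y ⊓ z, ⟨I.lower y hy _ inf_le_left, J.lower z hz _ inf_le_right⟩, ?_⟩
    have := hxy.inf hxz
    rwa [inf_idem] at this

/-- The improper ideal. -/
def whole : StoneCechLocale A where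
  carrier := Set.univ
  bot_mem := trivial
  lower _ _ _ _ := trivial
  sup_mem _ _ _ _ := trivial
  completelyRegular _ _ := ⟨⊤, trivial, CompletelyBelow.top.mono_left le_top⟩

instance : CompleteLattice (StoneCechLocale A) where
  __ := completeLatticeOfSup (StoneCechLocale A) isLUB_sSup
  inf := inter
  inf_le_left _ _ := Set.inter_subset_left
  inf_le_right _ _ := Set.inter_subset_right
  le_inf _ _ _ h h' := Set.subset_inter h h'
  top := whole
  le_top I := Set.subset_univ I.carrier

theorem carrier_inf (I J : StoneCechLocale A) : (I ⊓ J).carrier = I.carrier ∩ J.carrier := rfl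

theorem carrier_top : (⊤ : StoneCechLocale A).carrier = Set.univ := rfl

theorem inf_sSup_le (I : StoneCechLocale A) (𝓢 : Set (StoneCechLocale A)) :
    I ⊓ sSup 𝓢 ≤ ⨆ J ∈ 𝓢, I ⊓ J := by
  classical
  rintro x ⟨hxI, F, hF, hx⟩
  have h1 : x = (F.image (fun s => x ⊓ s)).sup id := by
    rw [Finset.sup_image]
    change x = F.sup (fun s => x ⊓ id s)
    rw [← Finset.sup_inf_distrib_left, inf_eq_left.2 hx]
  rw [h1]
  apply finset_sup_mem
  intro y hy
  rw [Finset.mem_coe, Finset.mem_image] at hy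
  obtain ⟨s, hs, rfl⟩ := hy
  obtain ⟨J, hJ, hsJ⟩ := Set.mem_iUnion₂.1 (hF hs)
  exact le_def.1 (le_iSup₂ (f := fun J _ => I ⊓ J) J hJ)
    ⟨I.lower x hxI _ inf_le_left, J.lower s hsJ _ inf_le_right⟩

/-- The frame of completely regular ideals of `A`. -/
instance : Order.Frame (StoneCechLocale A) := Order.Frame.ofMinimalAxioms ⟨inf_sSup_le⟩

variable (A) in
/-- The canonical locale map from `A` to its Stone–Čech compactification; its inverse image sends
a completely regular ideal to its join in `A`. -/
def unit : LocaleMap A (StoneCechLocale A) where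
  toFun I := sSup I.carrier
  map_inf' I J := by
    apply le_antisymm
    · exact le_inf (sSup_le_sSup Set.inter_subset_left) (sSup_le_sSup Set.inter_subset_right)
    · rw [sSup_inf_sSup]
      refine iSup₂_le fun p hp => le_sSup ?_
      exact ⟨I.lower _ hp.1 _ inf_le_left, J.lower _ hp.2 _ inf_le_right⟩
  map_top' := le_antisymm le_top (le_sSup (Set.mem_univ _))
  map_sSup' 𝓢 := by
    apply le_antisymm
    · apply sSup_le
      rintro x ⟨F, hF, hx⟩
      refine hx.trans (Finset.sup_le fun s hs => ?_)
      obtain ⟨J, hJ, hsJ⟩ := Set.mem_iUnion₂.1 (hF hs)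
      exact (le_sSup hsJ).trans (le_sSup ⟨J, hJ, rfl⟩)
    · apply sSup_le
      rintro _ ⟨J, hJ, rfl⟩
      exact sSup_le_sSup (le_def.1 ((isLUB_sSup 𝓢).1 hJ))

end StoneCechLocale

end StoneCech

/-! In a normal lattice `B` a cover `i ⊔ d = ⊤` shrinks to `e ⊔ d = ⊤` with `e` well inside `i`, the
witness lying in `B`. This relation therefore interpolates inside `B`, and iterating along the
dyadic rationals yields a scale in `A`. The elements of `A` below some `b ∈ B` well inside a member
of a `J_m`-ideal `I` thus form a completely regular ideal, and `I ↦ regularIdeal hB I` is the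
inverse image of `h`. Shrinking covers also shows that its composite with `unit A` is left adjoint
to `wallmanDirect B`. Uniqueness of `h` holds because the frame of `J_m`-ideals is regular and `unit
A` is dense.

The direct image of the unit sends `a` to `below a`. If `h` is an isomorphism, then `below b`
corresponds to the principal ideal `closure {b}`. These ideals form a sublattice and a base, the
covering condition on ideals becomes relative conjunctivity, and conjunctivity of `B` makes `closure
{b}` equal to `↓b`, whence injectivity.

Conversely, send `K` to `{b | below b ≤ K}`. Relative conjunctivity of the base says that this is a
`J_m`-ideal. The left adjoint sends `I` to the join of the `below b` with `b ∈ I`; the two are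
mutually inverse, on one side because of the base and on the other because of compactness of the
Stone–Čech locale. The uniqueness of `h` identifies this isomorphism with `h`. -/

/-! ### Scales from interpolative relations -/

section Scale

/-- The dyadic refinements of a pair `a, b`: the `n`-th refinement is a sequence from `a` (at `0`)
to `b` (at `2 ^ n`), and odd places of the next one are filled by `mid`. -/
def dyadicScale {X : Type*} (mid : X → X → X) (a b : X) : ℕ → ℕ → X
  | 0, k => if k = 0 then a else b
  | n + 1, k =>
    if k % 2 = 0 then dyadicScale mid a b n (k / 2)
    else mid (dyadicScale mid a b n (k / 2)) (dyadicScale mid a b n (k / 2 + 1))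

variable {X : Type*} (mid : X → X → X) (a b : X)

theorem dyadicScale_succ_two_mul (n k : ℕ) :
    dyadicScale mid a b (n + 1) (2 * k) = dyadicScale mid a b n k := by
  simp [dyadicScale]

theorem dyadicScale_succ_two_mul_add_one (n k : ℕ) :
    dyadicScale mid a b (n + 1) (2 * k + 1) =
      mid (dyadicScale mid a b n k) (dyadicScale mid a b n (k + 1)) := by
  have h1 : (2 * k + 1) % 2 = 1 := by omega
  have h2 : (2 * k + 1) / 2 = k := by omega
  simp [dyadicScale, h1, h2]

/-- Refinement keeps the old entries, so entries of different levels can be compared at a common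
level. -/
theorem dyadicScale_add (n m k : ℕ) :
    dyadicScale mid a b (n + m) (2 ^ m * k) = dyadicScale mid a b n k := by
  induction m with
  | zero => simp
  | succ m ih => rw [← add_assoc, pow_succ', mul_assoc, dyadicScale_succ_two_mul, ih]

theorem dyadicScale_zero (n : ℕ) : dyadicScale mid a b n 0 = a := by
  have := dyadicScale_add mid a b 0 n 0
  simpa [dyadicScale] using this

theorem dyadicScale_two_pow (n : ℕ) : dyadicScale mid a b n (2 ^ n) = b := by
  have := dyadicScale_add mid a b 0 n 1
  simpa [dyadicScale] using this

/-- The bound `2 ^ n` matters: past it the sequence no longer runs from `a` to `b`, and `R b b` may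
fail. -/
theorem dyadicScale_rel {R : X → X → Prop}
    (hmid : ∀ x y, R x y → R x (mid x y) ∧ R (mid x y) y) (hab : R a b) (n : ℕ) :
    ∀ k < 2 ^ n, R (dyadicScale mid a b n k) (dyadicScale mid a b n (k + 1)) := by
  induction n with
  | zero =>
    intro k hk
    obtain rfl : k = 0 := by simpa using hk
    simpa [dyadicScale] using hab
  | succ n ih =>
    intro k hk
    rw [pow_succ'] at hk
    obtain ⟨j, rfl | rfl⟩ := Nat.even_or_odd' k
    · rw [dyadicScale_succ_two_mul, dyadicScale_succ_two_mul_add_one]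
      exact (hmid _ _ (ih j (by omega))).1
    · rw [dyadicScale_succ_two_mul_add_one, show 2 * j + 1 + 1 = 2 * (j + 1) by ring,
        dyadicScale_succ_two_mul]
      exact (hmid _ _ (ih j (by omega))).2

end Scale

/-! ### Interpolation and the relation of being completely below -/

section Frame

variable {A : Type*} [Order.Frame A]

theorem WellInside.mono {a b a' b' : A} (ha : a' ≤ a) (h : WellInside a b) (hb : b ≤ b') :
    WellInside a' b' := by
  obtain ⟨c, h0, h1⟩ := h
  exact ⟨c, le_bot_iff.1 (h0 ▸ inf_le_inf_left c ha), top_le_iff.1 (h1 ▸ sup_le_sup_left hb c)⟩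

/-- An interpolative relation contained in `WellInside` is contained in `CompletelyBelow`. -/
theorem CompletelyBelow.of_interpolative {R : A → A → Prop} (hR : ∀ x y, R x y → WellInside x y)
    (hint : ∀ x y, R x y → ∃ z, R x z ∧ R z y) {a b : A} (hab : R a b) : CompletelyBelow a b := by
  classical
  choose! mid hmid using hint
  set D := dyadicScale mid a b with hD
  have hrel : ∀ n, ∀ k < 2 ^ n, R (D n k) (D n (k + 1)) := dyadicScale_rel mid a b hmid hab
  have hmono : ∀ n k l, k ≤ l → l ≤ 2 ^ n → D n k ≤ D n l := by
    intro n k l hkl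
    induction l, hkl using Nat.le_induction with
    | base => exact fun _ => le_rfl
    | succ l _ ih => exact fun hl => (ih (by omega)).trans (hR _ _ (hrel n l (by omega))).le
  have hadd : ∀ n m k, D (n + m) (2 ^ m * k) = D n k := dyadicScale_add mid a b
  -- The value at `q` is the join of the entries at the dyadic approximations of `q` from below.
  refine ⟨fun q => ⨆ n : ℕ, D n ⌊q * 2 ^ n⌋₊, ?_, ?_, ?_⟩
  · simp [hD, dyadicScale_zero]
  · have h1 : ∀ n : ℕ, ⌊(1 : ℚ) * 2 ^ n⌋₊ = 2 ^ n := fun n => by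
      rw [one_mul]
      exact_mod_cast Nat.floor_natCast (R := ℚ) (2 ^ n)
    simp only [h1, hD, dyadicScale_two_pow, ciSup_const]
  · intro p q hp hpq hq
    -- A gap of more than two mesh widths leaves the full step from `K + 1` to `K + 2` between the
    -- approximations of `p` and those of `q`.
    obtain ⟨n, hn⟩ := pow_unbounded_of_one_lt (2 / (q - p)) (one_lt_two (α := ℚ))
    rw [div_lt_iff₀ (sub_pos.2 hpq)] at hn
    have h2n : (0 : ℚ) < 2 ^ n := by positivity
    set K := ⌊p * 2 ^ n⌋₊ with hK
    have hKp : (K : ℚ) ≤ p * 2 ^ n := Nat.floor_le (by positivity)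
    have hpK : p * 2 ^ n < K + 1 := Nat.lt_floor_add_one _
    have hKq : K + 2 ≤ ⌊q * 2 ^ n⌋₊ := by
      apply Nat.le_floor
      push_cast
      linarith
    have hfloor : ∀ r : ℚ, r ≤ 1 → ∀ m : ℕ, ⌊r * 2 ^ m⌋₊ ≤ 2 ^ m := by
      intro r hr m
      apply Nat.floor_le_of_le
      push_cast
      exact mul_le_of_le_one_left (by positivity) hr
    have hK2 : K + 2 ≤ 2 ^ n := hKq.trans (hfloor q hq n)
    refine (hR _ _ (hrel n (K + 1) (by omega))).mono (iSup_le fun m => ?_)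
      ((hmono n _ _ hKq (hfloor q hq n)).trans (le_iSup (fun n => D n ⌊q * 2 ^ n⌋₊) n))
    -- Both entries are moved to level `n + m`, where monotonicity in the index applies.
    rw [← hadd n m, ← hadd m n, add_comm m n]
    refine hmono _ _ _ ?_ ?_
    · have h1 : ((2 ^ n * ⌊p * 2 ^ m⌋₊ : ℕ) : ℚ) ≤ ((2 ^ m * (K + 1) : ℕ) : ℚ) := by
        push_cast
        have h3 : (⌊p * 2 ^ m⌋₊ : ℚ) ≤ p * 2 ^ m := Nat.floor_le (by positivity)
        calc (2 : ℚ) ^ n * (⌊p * 2 ^ m⌋₊ : ℚ) ≤ 2 ^ n * (p * 2 ^ m) := by gcongr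
          _ = 2 ^ m * (p * 2 ^ n) := by ring
          _ ≤ 2 ^ m * (K + 1) := by gcongr
      exact_mod_cast h1
    · rw [add_comm n m, pow_add]
      exact Nat.mul_le_mul_left _ (by omega)

theorem CompletelyBelow.mono_right {a b c : A} (h : CompletelyBelow a b) (hbc : b ≤ c) :
    CompletelyBelow a c := by
  obtain ⟨u, h0, h1, hu⟩ := h
  refine ⟨fun q => if q = 1 then c else u q, by simp [h0], by simp, ?_⟩
  intro p q hp hpq hq
  have hp1 : p ≠ 1 := (hpq.trans_le hq).ne
  simp only [hp1, if_false]
  split_ifs with hq1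
  · subst hq1
    exact (hu p 1 hp hpq hq).mono le_rfl (h1 ▸ hbc)
  · exact hu p q hp hpq hq

/-- Cut the scale at `1 / 2` and rescale both halves. -/
theorem CompletelyBelow.interpolate {a b : A} (h : CompletelyBelow a b) :
    ∃ c, CompletelyBelow a c ∧ CompletelyBelow c b := by
  obtain ⟨u, h0, h1, hu⟩ := h
  refine ⟨u (1 / 2), ⟨fun q => u (q / 2), by simp [h0], rfl, ?_⟩,
    ⟨fun q => u ((q + 1) / 2), by norm_num, by norm_num [h1], ?_⟩⟩
  · intro p q hp hpq hq
    exact hu _ _ (by linarith) (by linarith) (by linarith)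
  · intro p q hp hpq hq
    exact hu _ _ (by linarith) (by linarith) (by linarith)

end Frame

/-! ### Normal lattices and their maximal ideals -/

section Lattice

variable {D : Type*} [DistribLattice D] [BoundedOrder D]

/-- `a` is well inside `b`, with a witness in the lattice `D` itself. -/
def WellInsideIn (a b : D) : Prop := ∃ c : D, c ⊓ a = ⊥ ∧ c ⊔ b = ⊤

theorem le_of_inf_eq_bot_of_sup_eq_top {a b c : D} (h0 : c ⊓ a = ⊥) (h1 : c ⊔ b = ⊤) : a ≤ b :=
  calc a = a ⊓ (c ⊔ b) := by rw [h1, inf_top_eq]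
    _ = (c ⊓ a) ⊔ (a ⊓ b) := by rw [inf_sup_left, inf_comm a c]
    _ ≤ b := by rw [h0, bot_sup_eq]; exact inf_le_right

namespace WellInsideIn

theorem bot (b : D) : WellInsideIn ⊥ b := ⟨⊤, inf_bot_eq _, top_sup_eq _⟩

theorem top (a : D) : WellInsideIn a ⊤ := ⟨⊥, bot_inf_eq _, sup_top_eq _⟩

theorem sup {a b a' b' : D} (h : WellInsideIn a b) (h' : WellInsideIn a' b') :
    WellInsideIn (a ⊔ a') (b ⊔ b') := by
  obtain ⟨c, h0, h1⟩ := h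
  obtain ⟨c', h0', h1'⟩ := h'
  refine ⟨c ⊓ c', ?_, ?_⟩
  · rw [inf_sup_left, inf_right_comm, h0, bot_inf_eq, bot_sup_eq, inf_assoc, h0', inf_bot_eq]
  · rw [sup_inf_right, ← sup_assoc, h1, top_sup_eq, sup_left_comm, h1', sup_top_eq, inf_top_eq]

theorem inf {a b a' b' : D} (h : WellInsideIn a b) (h' : WellInsideIn a' b') :
    WellInsideIn (a ⊓ a') (b ⊓ b') := by
  obtain ⟨c, h0, h1⟩ := h
  obtain ⟨c', h0', h1'⟩ := h'
  refine ⟨c ⊔ c', ?_, ?_⟩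
  · rw [inf_sup_right, ← inf_assoc, h0, bot_inf_eq, inf_left_comm, h0', inf_bot_eq, sup_bot_eq]
  · rw [sup_inf_left, sup_right_comm, h1, top_sup_eq, sup_assoc, h1', sup_top_eq, inf_top_eq]

end WellInsideIn

namespace IsNormalLattice

/-- This is the form in which normality gets used: one member of a binary cover is replaced by an
element well inside it. -/
theorem shrink (hD : IsNormalLattice D) {i d : D} (h : i ⊔ d = ⊤) :
    ∃ e, WellInsideIn e i ∧ e ⊔ d = ⊤ := by
  obtain ⟨c, e, h1, h2, h3⟩ := hD i d h
  exact ⟨e, ⟨c, h3, h1⟩, by rwa [sup_comm]⟩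

/-- Shrink `b` in the cover `b ⊔ c = ⊤` given by the witness `c`; the same `c` then witnesses that
`a` is well inside the shrunken element. -/
theorem interpolate (hD : IsNormalLattice D) {a b : D} (h : WellInsideIn a b) :
    ∃ e, WellInsideIn a e ∧ WellInsideIn e b := by
  obtain ⟨c, h0, h1⟩ := h
  rw [sup_comm] at h1
  obtain ⟨e, he, hec⟩ := hD.shrink h1
  exact ⟨e, ⟨c, h0, by rwa [sup_comm]⟩, he⟩

end IsNormalLattice

/-! ### Principal ideals for the maximal topology -/

namespace MaxIdeal

/-- In contrast with `MaximalCover`, the members of `F` need not lie below `x`. -/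
theorem mem_of_forall (I : MaxIdeal D) {x : D}
    (h : ∀ d : D, x ⊔ d = ⊤ → ∃ F : Finset D, (F : Set D) ⊆ I.carrier ∧ F.sup id ⊔ d = ⊤) :
    x ∈ I.carrier :=
  (closure_le_iff.2 (Set.Subset.refl I.carrier) : closure I.carrier ≤ I) h

theorem finset_sup_mem (I : MaxIdeal D) (F : Finset D) (hF : (F : Set D) ⊆ I.carrier) :
    F.sup id ∈ I.carrier :=
  I.mem_of_forall fun _ hd => ⟨F, hF, hd⟩

theorem bot_mem (I : MaxIdeal D) : ⊥ ∈ I.carrier := by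
  simpa using I.finset_sup_mem ∅ (by simp)

theorem sup_mem (I : MaxIdeal D) {x y : D} (hx : x ∈ I.carrier) (hy : y ∈ I.carrier) :
    x ⊔ y ∈ I.carrier := by
  classical
  simpa using I.finset_sup_mem {x, y} (by simp [Set.insert_subset_iff, hx, hy])

theorem eq_top_iff {I : MaxIdeal D} : I = ⊤ ↔ ⊤ ∈ I.carrier := by
  constructor
  · rintro rfl
    exact (le_top : closure {⊤} ≤ (⊤ : MaxIdeal D)) (subset_closure _ rfl)
  · intro h
    refine top_le_iff.1 fun x _ => I.lower _ h x le_top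

theorem mem_closure_singleton {b x : D} :
    x ∈ (closure {b}).carrier ↔ ∀ d : D, x ⊔ d = ⊤ → b ⊔ d = ⊤ := by
  constructor
  · intro h d hd
    obtain ⟨F, hF, hFd⟩ := h d hd
    have : F.sup id ≤ b := Finset.sup_le fun s hs => (hF hs : s = b).le
    exact top_le_iff.1 (hFd ▸ sup_le_sup_right this d)
  · intro h d hd
    exact ⟨{b}, by simp, by simpa using h d hd⟩

theorem closure_singleton_le {b : D} {I : MaxIdeal D} : closure {b} ≤ I ↔ b ∈ I.carrier := by
  rw [closure_le_iff, Set.singleton_subset_iff]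

theorem closure_singleton_mono {a b : D} (h : a ≤ b) : closure {a} ≤ closure {b} :=
  closure_singleton_le.2 ((closure {b}).lower b (subset_closure _ rfl) a h)

theorem closure_singleton_top : closure {(⊤ : D)} = ⊤ :=
  eq_top_iff.2 (subset_closure _ rfl)

theorem closure_singleton_bot : closure {(⊥ : D)} = ⊥ :=
  le_bot_iff.1 (closure_singleton_le.2 (bot_mem _))

theorem closure_singleton_sup (a b : D) : closure {a ⊔ b} = closure {a} ⊔ closure {b} := by
  apply le_antisymm
  · refine closure_singleton_le.2 (sup_mem _ ?_ ?_)
    · exact closure_singleton_le.1 le_sup_left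
    · exact closure_singleton_le.1 le_sup_right
  · exact sup_le (closure_singleton_mono le_sup_left) (closure_singleton_mono le_sup_right)

theorem closure_singleton_inf (a b : D) : closure {a ⊓ b} = closure {a} ⊓ closure {b} := by
  apply le_antisymm
  · exact le_inf (closure_singleton_mono inf_le_left) (closure_singleton_mono inf_le_right)
  · rintro x ⟨hxa, hxb⟩
    rw [mem_closure_singleton] at *
    intro d hd
    rw [sup_inf_right, hxa d hd, hxb d hd, inf_top_eq]

/-- Conjunctivity says exactly that principal lower sets are already closed. -/
theorem mem_closure_singleton_of_isConjunctive (hD : IsConjunctiveLattice D) {b x : D} :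
    x ∈ (closure {b}).carrier ↔ x ≤ b := by
  refine ⟨fun h => hD x b (mem_closure_singleton.1 h), fun h => ?_⟩
  exact (closure {b}).lower b (subset_closure _ rfl) x h

theorem wellInside_closure_singleton {a b : D} (h : WellInsideIn a b) :
    WellInside (closure {a}) (closure {b}) := by
  obtain ⟨c, h0, h1⟩ := h
  refine ⟨closure {c}, ?_, ?_⟩
  · rw [← closure_singleton_inf, h0, closure_singleton_bot]
  · rw [← closure_singleton_sup, h1, closure_singleton_top]

/-- The frame of ideals of a normal lattice for the maximal topology is regular. -/
theorem isLUB_wellInside (hD : IsNormalLattice D) (I : MaxIdeal D) :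
    IsLUB {J : MaxIdeal D | WellInside J I} I := by
  refine ⟨fun J hJ => WellInside.le hJ, fun K hK i hi => ?_⟩
  refine K.mem_of_forall fun d hd => ?_
  obtain ⟨e, he, hed⟩ := hD.shrink hd
  refine ⟨{e}, ?_, by simpa using hed⟩
  rw [Finset.coe_singleton, Set.singleton_subset_iff]
  refine closure_singleton_le.1 (hK ?_)
  exact (wellInside_closure_singleton he).mono le_rfl (closure_singleton_le.2 hi)

end MaxIdeal

end Lattice

/-! ### Maps out of regular frames -/

/-- Frame homomorphisms from a regular frame which agree after composition with a dense frame
homomorphism are equal. -/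
theorem FrameHom.eq_of_comp_eq_of_dense {W K A : Type*} [Order.Frame W] [Order.Frame K]
    [Order.Frame A] (hW : ∀ w : W, IsLUB {v : W | WellInside v w} w) {u : FrameHom K A}
    (hu : ∀ x, u x = ⊥ → x = ⊥) {f k : FrameHom W K} (h : u.comp f = u.comp k) : f = k := by
  have key : ∀ f k : FrameHom W K, u.comp f = u.comp k → ∀ w, f w ≤ k w := by
    intro f k h w
    have hw : w = sSup {v : W | WellInside v w} := (hW w).sSup_eq.symm
    conv_lhs => rw [hw]
    rw [map_sSup]
    apply sSup_le
    rintro _ ⟨v, ⟨c, hc0, hc1⟩, rfl⟩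
    -- If `c` witnesses that `v` is well inside `w`, then `k c` covers together with `k w`, and it
    -- is disjoint from `f v` because `u` is dense and cannot tell `f v` from `k v`.
    refine le_of_inf_eq_bot_of_sup_eq_top (c := k c) (hu _ ?_) ?_
    · have h1 : u (f v) = u (k v) := DFunLike.congr_fun h v
      rw [map_inf, h1, ← map_inf, ← map_inf, hc0, map_bot, map_bot]
    · rw [← map_sup, hc1, map_top]
  exact FrameHom.ext fun w => le_antisymm (key f k h w) (key k f h.symm w)

namespace LocaleMap

variable {X Y : Type*} [Order.Frame X] [Order.Frame Y]

theorem direct_eq_of_gc (f : LocaleMap X Y) {r : X → Y} (h : GaloisConnection f r) :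
    direct f = r :=
  funext fun _ => (gc f).u_unique h fun _ => rfl

theorem eq_of_direct_eq {f k : LocaleMap X Y} (h : direct f = direct k) : f = k :=
  FrameHom.ext fun _ => (gc f).l_unique (gc k) (fun x => congrFun h x)

end LocaleMap

/-! ### The direct image of the unit of the Stone–Čech compactification -/

namespace StoneCechLocale

variable {A : Type*} [Order.Frame A]

/-- The completely regular ideal of the elements completely below `a`. -/
def below (a : A) : StoneCechLocale A where
  carrier := {x | CompletelyBelow x a}
  bot_mem := CompletelyBelow.bot.mono_right bot_le
  lower _ hx _ hyx := CompletelyBelow.mono_left hyx hx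
  sup_mem x hx y hy := by
    have := CompletelyBelow.sup hx hy
    rwa [sup_idem] at this
  completelyRegular _ hx := by
    obtain ⟨c, h1, h2⟩ := CompletelyBelow.interpolate hx
    exact ⟨c, h2, h1⟩

theorem unit_apply (I : StoneCechLocale A) : unit A I = sSup I.carrier := rfl

/-- Each member of a completely regular ideal is completely below another member, hence completely
below any upper bound of the ideal. -/
theorem direct_unit : LocaleMap.direct (unit A) = below := by
  refine LocaleMap.direct_eq_of_gc _ fun I a => ?_
  rw [unit_apply]
  constructor
  · intro h x hx
    obtain ⟨y, hy, hxy⟩ := I.completelyRegular x hx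
    exact hxy.mono_right ((le_sSup hy).trans h)
  · intro h
    exact sSup_le fun x hx => CompletelyBelow.le (h hx)

theorem below_mono {a b : A} (h : a ≤ b) : below a ≤ below b :=
  fun _ hx => CompletelyBelow.mono_right hx h

theorem below_inf (a b : A) : below (a ⊓ b) = below a ⊓ below b := by
  refine le_antisymm (le_inf (below_mono inf_le_left) (below_mono inf_le_right)) ?_
  rintro x ⟨ha, hb⟩
  have := CompletelyBelow.inf ha hb
  rwa [inf_idem] at this

theorem below_top : below (⊤ : A) = ⊤ :=
  top_le_iff.1 fun _ _ => CompletelyBelow.top.mono_left le_top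

theorem below_eq_top {a : A} : below a = ⊤ ↔ a = ⊤ := by
  constructor
  · intro h
    have : (⊤ : A) ∈ (below a).carrier := by rw [h, carrier_top]; trivial
    exact top_le_iff.1 (CompletelyBelow.le this)
  · rintro rfl
    exact below_top

theorem unit_dense (I : StoneCechLocale A) (h : unit A I = ⊥) : I = ⊥ := by
  rw [unit_apply] at h
  refine le_bot_iff.1 fun x hx => ?_
  have : x = ⊥ := le_bot_iff.1 (h ▸ le_sSup hx)
  rw [this]
  exact (⊥ : StoneCechLocale A).bot_mem

theorem below_injective (hA : IsCompletelyRegularLocale A) :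
    Function.Injective (below : A → StoneCechLocale A) := by
  intro a b h
  have hle : ∀ a b : A, below a ≤ below b → a ≤ b := fun a b h =>
    (hA a).2 fun x hx => CompletelyBelow.le (h hx)
  exact le_antisymm (hle a b h.le) (hle b a h.ge)

/-- Compactness of `StoneCechLocale A`, for directed joins of ideals `below a`. -/
theorem exists_eq_top_of_iSup_below_eq_top {ι : Type*} [Nonempty ι] {f : ι → A}
    (hf : Directed (· ≤ ·) f) (h : ⨆ i, below (f i) = ⊤) : ∃ i, f i = ⊤ := by
  have htop : (⊤ : A) ∈ (⨆ i, below (f i)).carrier := by rw [h, carrier_top]; trivial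
  obtain ⟨F, hF, hle⟩ := htop
  have key : ∃ i, F.sup id ∈ (below (f i)).carrier := by
    refine Finset.sup_induction (p := fun x => ∃ i, x ∈ (below (f i)).carrier) ?_ ?_ ?_
    · exact ⟨Classical.arbitrary ι, (below _).bot_mem⟩
    · rintro x ⟨i, hi⟩ y ⟨j, hj⟩
      obtain ⟨k, hik, hjk⟩ := hf i j
      exact ⟨k, (below (f k)).sup_mem _ (below_mono hik hi) _ (below_mono hjk hj)⟩
    · intro x hx
      obtain ⟨_, ⟨i, rfl⟩, hi⟩ := Set.mem_iUnion₂.1 (hF hx)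
      exact ⟨i, hi⟩
  obtain ⟨i, hi⟩ := key
  exact ⟨i, top_le_iff.1 (hle.trans (CompletelyBelow.le hi))⟩

end StoneCechLocale

/-! ### The comparison map for a normal sublattice -/

namespace BoundedSublattice

open StoneCechLocale

variable {A : Type*} [Order.Frame A] {B : BoundedSublattice A}

/-- The witnesses must stay in `B`: that relation interpolates by normality, while `WellInside` in
`A` need not. -/
theorem completelyBelow_of_wellInsideIn (hB : IsNormalLattice B.Elem) {a b : B.Elem}
    (h : WellInsideIn a b) : CompletelyBelow (a : A) (b : A) := by
  refine CompletelyBelow.of_interpolative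
    (R := fun x y => ∃ a b : B.Elem, (a : A) = x ∧ (b : A) = y ∧ WellInsideIn a b) ?_ ?_
    ⟨a, b, rfl, rfl, h⟩
  · rintro _ _ ⟨a, b, rfl, rfl, c, h0, h1⟩
    exact ⟨c, congrArg Subtype.val h0, congrArg Subtype.val h1⟩
  · rintro _ _ ⟨a, b, rfl, rfl, h⟩
    obtain ⟨e, h1, h2⟩ := hB.interpolate h
    exact ⟨e, ⟨a, e, rfl, rfl, h1⟩, ⟨e, b, rfl, rfl, h2⟩⟩

/-- The completely regular ideal generated by the elements well inside some element of `I`. -/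
def regularIdeal (hB : IsNormalLattice B.Elem) (I : MaxIdeal B.Elem) : StoneCechLocale A where
  carrier := {x | ∃ b i : B.Elem, i ∈ I.carrier ∧ WellInsideIn b i ∧ x ≤ b}
  bot_mem := ⟨⊥, ⊥, I.bot_mem, WellInsideIn.bot _, bot_le⟩
  lower := fun _ ⟨b, i, hi, hbi, hx⟩ _ hyx => ⟨b, i, hi, hbi, hyx.trans hx⟩
  sup_mem := fun _ ⟨b, i, hi, hbi, hx⟩ _ ⟨b', i', hi', hbi', hx'⟩ =>
    ⟨b ⊔ b', i ⊔ i', I.sup_mem hi hi', hbi.sup hbi', sup_le_sup hx hx'⟩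
  completelyRegular := by
    rintro x ⟨b, i, hi, hbi, hx⟩
    obtain ⟨e, hbe, hei⟩ := hB.interpolate hbi
    exact ⟨e, ⟨e, i, hi, hei, le_rfl⟩,
      (completelyBelow_of_wellInsideIn hB hbe).mono_left hx⟩

theorem mem_regularIdeal {hB : IsNormalLattice B.Elem} {I : MaxIdeal B.Elem} {x : A} :
    x ∈ (regularIdeal hB I).carrier ↔
      ∃ b i : B.Elem, i ∈ I.carrier ∧ WellInsideIn b i ∧ x ≤ b := Iff.rfl

theorem regularIdeal_mono (hB : IsNormalLattice B.Elem) {I J : MaxIdeal B.Elem} (h : I ≤ J) :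
    regularIdeal hB I ≤ regularIdeal hB J :=
  fun _ ⟨b, i, hi, hbi, hx⟩ => ⟨b, i, h hi, hbi, hx⟩

/-- The locale map from the Stone–Čech compactification of `A` to the locale of ideals of a normal
sublattice for the maximal topology. -/
def comparison (hB : IsNormalLattice B.Elem) :
    LocaleMap (StoneCechLocale A) (MaxIdeal B.Elem) where
  toFun := regularIdeal hB
  map_inf' I J := by
    apply le_antisymm
    · exact le_inf (regularIdeal_mono hB inf_le_left) (regularIdeal_mono hB inf_le_right)
    · rintro x ⟨⟨b, i, hi, hbi, hx⟩, ⟨b', i', hi', hbi', hx'⟩⟩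
      exact ⟨b ⊓ b', i ⊓ i', ⟨I.lower _ hi _ inf_le_left, J.lower _ hi' _ inf_le_right⟩,
        hbi.inf hbi', le_inf hx hx'⟩
  map_top' := top_le_iff.1 fun x _ =>
    ⟨⊤, ⊤, MaxIdeal.eq_top_iff.1 rfl, WellInsideIn.top _, le_top⟩
  map_sSup' 𝓢 := by
    apply le_antisymm
    · rintro x ⟨b, i, hi, ⟨c, hcb, hci⟩, hx⟩
      rw [sup_comm] at hci
      obtain ⟨G, hG, hGc⟩ := hi c hci
      -- Shrink every member of the finite cover `G` against `c`. Since `c` is disjoint from `b`,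
      -- the resulting cover bounds `b`.
      obtain ⟨F, hF, hFc⟩ := MaxIdeal.refine_cover
        (S := {e : B.Elem | ∃ J ∈ 𝓢, ∃ j ∈ J.carrier, WellInsideIn e j})
        (T := ⋃ J ∈ 𝓢, J.carrier) (fun t ht d hd => by
          obtain ⟨J, hJ, htJ⟩ := Set.mem_iUnion₂.1 ht
          obtain ⟨e, het, hed⟩ := hB.shrink hd
          exact ⟨{e}, Finset.coe_singleton e ▸ Set.singleton_subset_iff.2 ⟨J, hJ, t, htJ, het⟩,
            by simpa using hed⟩) G hG c hGc
      rw [sup_comm] at hFc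
      have hbF : b ≤ F.sup id := le_of_inf_eq_bot_of_sup_eq_top hcb hFc
      have hmem : ((F.sup id : B.Elem) : A) ∈ (sSup (regularIdeal hB '' 𝓢)).carrier := by
        refine Finset.sup_induction
          (p := fun e : B.Elem => (e : A) ∈ (sSup (regularIdeal hB '' 𝓢)).carrier) ?_ ?_ ?_
        · exact StoneCechLocale.bot_mem _
        · intro e he e' he'
          exact StoneCechLocale.sup_mem _ _ he _ he'
        · intro e he
          obtain ⟨J, hJ, j, hj, hej⟩ := hF he
          exact StoneCechLocale.le_def.1
            (le_sSup (Set.mem_image_of_mem (regularIdeal hB) hJ)) ⟨e, j, hj, hej, le_rfl⟩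
      exact StoneCechLocale.lower _ _ hmem _ (hx.trans hbF)
    · apply sSup_le
      rintro _ ⟨J, hJ, rfl⟩
      exact regularIdeal_mono hB (le_sSup hJ)

theorem exists_le_of_mem_wallmanDirect {a : A} {x d : B.Elem}
    (hx : x ∈ (wallmanDirect B a).carrier) (hd : x ⊔ d = ⊤) :
    ∃ e : B.Elem, (e : A) ≤ a ∧ e ⊔ d = ⊤ := by
  obtain ⟨F, hF, hFd⟩ := hx d hd
  refine ⟨F.sup id, ?_, hFd⟩
  exact Finset.sup_induction (p := fun e : B.Elem => (e : A) ≤ a) bot_le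
    (fun _ h _ h' => sup_le h h') fun _ he => hF he

/-- In one direction covers by `i ∈ I` are shrunk to elements below `a`; in the other, the witness
that `b` is well inside `i` turns a cover by some `e ≤ a` into `b ≤ e`. -/
theorem direct_compose_comparison (hB : IsNormalLattice B.Elem) :
    LocaleMap.direct (LocaleMap.compose (comparison hB) (unit A)) = wallmanDirect B := by
  refine LocaleMap.direct_eq_of_gc _ fun I a => ?_
  change sSup (regularIdeal hB I).carrier ≤ a ↔ _
  constructor
  · intro h i hi d hd
    obtain ⟨e, hei, hed⟩ := hB.shrink hd
    refine ⟨{e}, ?_, by simpa using hed⟩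
    rw [Finset.coe_singleton, Set.singleton_subset_iff]
    exact (le_sSup (mem_regularIdeal.2 ⟨e, i, hi, hei, le_rfl⟩)).trans h
  · intro h
    apply sSup_le
    rintro x ⟨b, i, hi, ⟨c, hcb, hci⟩, hx⟩
    rw [sup_comm] at hci
    obtain ⟨e, hea, hec⟩ := exists_le_of_mem_wallmanDirect (h hi) hci
    rw [sup_comm] at hec
    have hbe : b ≤ e := le_of_inf_eq_bot_of_sup_eq_top hcb hec
    exact hx.trans (le_trans hbe hea)

theorem eq_comparison (hB : IsNormalLattice B.Elem)
    {h : LocaleMap (StoneCechLocale A) (MaxIdeal B.Elem)}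
    (hh : LocaleMap.compose h (unit A) = LocaleMap.compose (comparison hB) (unit A)) :
    h = comparison hB :=
  FrameHom.eq_of_comp_eq_of_dense (MaxIdeal.isLUB_wellInside hB) unit_dense hh

theorem wallmanDirect_coe (b : B.Elem) : wallmanDirect B (b : A) = MaxIdeal.closure {b} := by
  apply le_antisymm
  · exact MaxIdeal.closure_le_iff.2 fun x hx =>
      (MaxIdeal.closure {b}).lower b (MaxIdeal.subset_closure _ rfl) x hx
  · exact MaxIdeal.closure_singleton_le.2 (MaxIdeal.subset_closure _ (le_refl (b : A)))

/-! #### If the comparison map is an isomorphism -/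

/-- The direct image of an isomorphism is inverse to its inverse image, so `g_* = h_* η_*` can be
solved for `η_*`; on `b ∈ B` the value of `g_*` is `closure {b}`. -/
theorem below_eq_of_isIso (hB : IsNormalLattice B.Elem) (hiso : LocaleMap.IsIso (comparison hB))
    (b : B.Elem) : below (b : A) = comparison hB (MaxIdeal.closure {b}) := by
  obtain ⟨k, hk1, _⟩ := hiso
  have h1 : ∀ x, comparison hB (k x) = x := DFunLike.congr_fun hk1
  rw [← wallmanDirect_coe, ← direct_compose_comparison hB, ← direct_unit]
  have hgc := LocaleMap.gc (LocaleMap.compose (comparison hB) (unit A))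
  apply le_antisymm
  · rw [← h1 (LocaleMap.direct (unit A) b)]
    refine OrderHomClass.mono (comparison hB) ((hgc _ _).1 ?_)
    change unit A (comparison hB (k _)) ≤ _
    rw [h1]
    exact (LocaleMap.gc (unit A)).l_u_le _
  · exact ((LocaleMap.gc (unit A)) _ _).1 (hgc.l_u_le _)

theorem isConjunctiveBase_of_isIso (hB : IsNormalLattice B.Elem)
    (hconj : IsConjunctiveLattice B.Elem) (hiso : LocaleMap.IsIso (comparison hB)) :
    Set.InjOn (below : A → StoneCechLocale A) B.carrier ∧
      IsConjunctiveBase ((below : A → StoneCechLocale A) '' B.carrier) := by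
  have hbelow := below_eq_of_isIso hB hiso
  obtain ⟨k, hk1, hk2⟩ := hiso
  have h1 : ∀ x, comparison hB (k x) = x := DFunLike.congr_fun hk1
  have h2 : ∀ I, k (comparison hB I) = I := DFunLike.congr_fun hk2
  have hle : ∀ {b : B.Elem} {K}, below (b : A) ≤ K ↔ b ∈ (k K).carrier := by
    intro b K
    rw [hbelow, ← MaxIdeal.closure_singleton_le]
    constructor
    · intro h
      have := OrderHomClass.mono k h
      rwa [h2] at this
    · intro h
      have := OrderHomClass.mono (comparison hB) h
      rwa [h1] at this
  have hsup : ∀ b c : B.Elem, below (b : A) ⊔ below (c : A) = below ((b ⊔ c : B.Elem) : A) := by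
    intro b c
    rw [hbelow, hbelow, hbelow, MaxIdeal.closure_singleton_sup, map_sup]
  refine ⟨?_, ⟨⟨⟨below '' B.carrier, ?_, ?_⟩, ?_, ?_⟩, rfl, ?_, ?_⟩⟩
  · have hle' : ∀ b c : B.Elem, below (b : A) ≤ below (c : A) → b ≤ c := by
      intro b c h
      rw [hle, hbelow, h2] at h
      exact (MaxIdeal.mem_closure_singleton_of_isConjunctive hconj).1 h
    intro b hb c hc h
    exact le_antisymm (hle' ⟨b, hb⟩ ⟨c, hc⟩ h.le) (hle' ⟨c, hc⟩ ⟨b, hb⟩ h.ge)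
  · rintro _ ⟨b, hb, rfl⟩ _ ⟨c, hc, rfl⟩
    exact ⟨b ⊔ c, B.supClosed hb hc, (hsup ⟨b, hb⟩ ⟨c, hc⟩).symm⟩
  · rintro _ ⟨b, hb, rfl⟩ _ ⟨c, hc, rfl⟩
    exact ⟨b ⊓ c, B.infClosed hb hc, below_inf b c⟩
  · refine ⟨⊥, B.bot_mem, ?_⟩
    have := hbelow ⊥
    rwa [MaxIdeal.closure_singleton_bot, map_bot] at this
  · exact ⟨⊤, B.top_mem, below_top⟩
  · intro K
    refine ⟨{x | ∃ b : B.Elem, below (b : A) = x ∧ x ≤ K}, ?_, ?_⟩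
    · rintro _ ⟨b, rfl, _⟩
      exact ⟨b, b.2, rfl⟩
    · apply le_antisymm
      · exact sSup_le fun x ⟨_, _, hx⟩ => hx
      · set T := sSup {x | ∃ b : B.Elem, below (b : A) = x ∧ x ≤ K}
        -- An ideal is determined by its members, which correspond to the basic elements below `K`.
        have : k K ≤ k T := fun b hb => hle.1 (le_sSup ⟨b, rfl, hle.2 hb⟩)
        have := OrderHomClass.mono (comparison hB) this
        rwa [h1, h1] at this
  · rintro K _ ⟨b, hb, rfl⟩ hcov
    -- Under `hle`, relative conjunctivity becomes the closure of `k K` under covers.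
    refine (hle (b := ⟨b, hb⟩)).2 (MaxIdeal.mem_of_forall _ fun d hd => ?_)
    obtain ⟨_, ⟨e, he, rfl⟩, heK, hde⟩ := hcov (below (d : A)) ⟨d, d.2, rfl⟩ (by
      rw [sup_comm]
      refine (hsup ⟨b, hb⟩ d).trans ?_
      rw [hd]
      exact below_top)
    refine ⟨{⟨e, he⟩}, ?_, ?_⟩
    · rw [Finset.coe_singleton, Set.singleton_subset_iff]
      exact (hle (b := ⟨e, he⟩)).1 heK
    · rw [Finset.sup_singleton, id, sup_comm]
      have := (hsup d ⟨e, he⟩).symm.trans hde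
      exact Subtype.ext (below_eq_top.1 this)

/-! #### If the image of the sublattice is a conjunctive base -/

theorem mem_wallmanDirect_of_below_le_below (hB : IsNormalLattice B.Elem) {b : B.Elem} {a : A}
    (h : below (b : A) ≤ below a) : b ∈ (wallmanDirect B a).carrier := by
  intro d hd
  obtain ⟨e, heb, hed⟩ := hB.shrink hd
  refine ⟨{e}, ?_, by simpa using hed⟩
  rw [Finset.coe_singleton, Set.singleton_subset_iff]
  exact CompletelyBelow.le (h (completelyBelow_of_wellInsideIn hB heb))

theorem isIso_of_isConjunctiveBase (hB : IsNormalLattice B.Elem)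
    (hinj : Set.InjOn (below : A → StoneCechLocale A) B.carrier)
    (hbase : IsConjunctiveBase ((below : A → StoneCechLocale A) '' B.carrier)) :
    LocaleMap.IsIso (comparison hB) := by
  obtain ⟨C, hC, hCbase, hCconj⟩ := hbase
  have hmemC : ∀ b : B.Elem, below (b : A) ∈ C.carrier := fun b => hC ▸ ⟨b, b.2, rfl⟩
  have hofC : ∀ x ∈ C.carrier, ∃ b : B.Elem, below (b : A) = x := by
    intro x hx
    rw [hC] at hx
    obtain ⟨b, hb, rfl⟩ := hx
    exact ⟨⟨b, hb⟩, rfl⟩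
  -- An injective map that preserves binary meets reflects the order.
  have hle : ∀ b c : B.Elem, below (b : A) ≤ below (c : A) → b ≤ c := by
    intro b c h
    refine inf_eq_left.1 (Subtype.ext (hinj (b ⊓ c).2 b.2 ?_))
    exact (below_inf _ _).trans (inf_eq_left.2 h)
  -- The join lies in `C`, so it is `below e` for some `e ∈ B`, and order reflection gives `b ⊔ c ≤
  -- e`.
  have hsup : ∀ b c : B.Elem, below ((b ⊔ c : B.Elem) : A) = below (b : A) ⊔ below (c : A) := by
    intro b c
    obtain ⟨e, he⟩ := hofC _ (C.supClosed (hmemC b) (hmemC c))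
    apply le_antisymm
    · rw [← he]
      refine below_mono (sup_le (hle b e ?_) (hle c e ?_) : b ⊔ c ≤ e)
      · exact he ▸ le_sup_left
      · exact he ▸ le_sup_right
    · exact sup_le (below_mono (le_sup_left : b ≤ b ⊔ c)) (below_mono (le_sup_right : c ≤ b ⊔ c))
  let r : StoneCechLocale A → MaxIdeal B.Elem := fun K =>
    { carrier := {b | below (b : A) ≤ K}
      lower := fun x hx y hyx => (below_mono hyx).trans hx
      covered := by
        intro c S hS hSK
        refine hCconj K _ (hmemC c) fun x hx hxc => ?_
        obtain ⟨d, rfl⟩ := hofC x hx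
        rw [sup_comm, ← hsup, below_eq_top] at hxc
        obtain ⟨F, hF, hFd⟩ := hS.2 d (Subtype.ext hxc)
        refine ⟨_, hmemC (F.sup id), ?_, ?_⟩
        · refine Finset.sup_induction (p := fun e : B.Elem => below (e : A) ≤ K) ?_ ?_ ?_
          · obtain ⟨e, he⟩ := hofC _ C.bot_mem
            exact (below_mono bot_le).trans (he.le.trans bot_le)
          · intro e he e' he'
            rw [hsup]
            exact sup_le he he'
          · exact fun e he => hSK (hF he)
        · rw [sup_comm, ← hsup, hFd]
          exact below_top }
  let l : MaxIdeal B.Elem → StoneCechLocale A := fun I => ⨆ b : I.carrier, below ((b : B.Elem) : A)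
  have hgc : GaloisConnection l r := fun I K =>
    ⟨fun h b hb => (le_iSup (fun b : I.carrier => below ((b : B.Elem) : A)) ⟨b, hb⟩).trans h,
      fun h => iSup_le fun b => h b.2⟩
  have hlr : ∀ K, l (r K) = K := by
    intro K
    refine le_antisymm (hgc.l_u_le K) ?_
    obtain ⟨T, hT, hTK⟩ := hCbase K
    conv_lhs => rw [← hTK]
    refine sSup_le fun x hx => ?_
    obtain ⟨b, rfl⟩ := hofC x (hT hx)
    exact le_iSup (fun b : (r K).carrier => below ((b : B.Elem) : A))
      ⟨b, (le_sSup hx).trans hTK.le⟩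
  have hrl : ∀ I, r (l I) = I := by
    intro I
    refine le_antisymm (fun b hb => I.mem_of_forall fun d hd => ?_) (hgc.le_u_l I)
    have : Nonempty I.carrier := ⟨⟨⊥, I.bot_mem⟩⟩
    -- Compactness is applied to the directed family of the `i ⊔ d` with `i ∈ I`, so that a single
    -- member of `I` covers together with `d`.
    obtain ⟨i, hi⟩ := exists_eq_top_of_iSup_below_eq_top
      (f := fun i : I.carrier => (((i : B.Elem) ⊔ d : B.Elem) : A)) (by
        intro i j
        exact ⟨⟨i.1 ⊔ j.1, I.sup_mem i.2 j.2⟩,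
          sup_le_sup_right (le_sup_left : i.1 ≤ i.1 ⊔ j.1) d,
          sup_le_sup_right (le_sup_right : j.1 ≤ i.1 ⊔ j.1) d⟩) (by
        simp only [hsup]
        rw [← iSup_sup]
        refine top_le_iff.1 (le_trans ?_ (sup_le_sup_right hb (below (d : A))))
        rw [← hsup, hd]
        exact below_top.ge)
    exact ⟨{(i : B.Elem)}, by simp, by simpa using Subtype.ext hi⟩
  let e : MaxIdeal B.Elem ≃o StoneCechLocale A :=
    { toFun := l
      invFun := r
      left_inv := hrl
      right_inv := hlr
      map_rel_iff' := by
        intro I J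
        change l I ≤ l J ↔ I ≤ J
        rw [hgc, hrl] }
  let lhom : LocaleMap (StoneCechLocale A) (MaxIdeal B.Elem) := (e : FrameHom _ _)
  let rhom : LocaleMap (MaxIdeal B.Elem) (StoneCechLocale A) := (e.symm : FrameHom _ _)
  -- By uniqueness it is enough to compare composites with the unit, and these are determined by
  -- their direct images.
  have hl : lhom = comparison hB := by
    apply eq_comparison
    apply LocaleMap.eq_of_direct_eq
    rw [direct_compose_comparison]
    refine LocaleMap.direct_eq_of_gc _ fun I a => ?_
    have h1 : LocaleMap.compose lhom (unit A) I ≤ a ↔ I ≤ r (below a) := by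
      rw [← hgc, ← direct_unit]
      exact LocaleMap.gc (unit A) (l I) a
    rw [h1]
    have h2 : r (below a) = wallmanDirect B a := by
      apply le_antisymm
      · exact fun b hb => mem_wallmanDirect_of_below_le_below hB hb
      · exact MaxIdeal.closure_le_iff.2 fun b hb => below_mono hb
    rw [h2]
  rw [← hl]
  exact ⟨rhom, FrameHom.ext hlr, FrameHom.ext hrl⟩

/-! #### Conjunctive bases -/

theorem IsConjunctiveIn.isConjunctiveLattice (hconj : B.IsConjunctiveIn) :
    IsConjunctiveLattice B.Elem := by
  intro a b h
  refine hconj b a a.2 fun c hc hca => ⟨b, b.2, le_rfl, ?_⟩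
  rw [sup_comm] at hca ⊢
  exact congrArg Subtype.val (h ⟨c, hc⟩ (Subtype.ext hca))

/-- Let `y` bound everything completely below `a`. A cover of `⊤` by `c` and a basic `b ≤ a` shrinks
to one by `c` and some `e` completely below `a`, so `e ≤ y`, and relative conjunctivity gives `b ≤
y`. -/
theorem IsBase.isCompletelyRegularLocale (hB : IsNormalLattice B.Elem) (hbase : B.IsBase)
    (hconj : B.IsConjunctiveIn) : IsCompletelyRegularLocale A := by
  refine fun a => ⟨fun x hx => CompletelyBelow.le hx, fun y hy => ?_⟩
  obtain ⟨T, hT, rfl⟩ := hbase a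
  refine sSup_le fun b hb => hconj y b (hT hb) fun c hc hcb => ?_
  rw [sup_comm] at hcb
  obtain ⟨e, heb, hec⟩ := hB.shrink
    (i := ⟨b, hT hb⟩) (d := (⟨c, hc⟩ : B.Elem)) (Subtype.ext hcb)
  refine ⟨e, e.2, hy ((completelyBelow_of_wellInsideIn hB heb).mono_right (le_sSup hb)), ?_⟩
  rw [sup_comm]
  exact congrArg Subtype.val hec

end BoundedSublattice

/-! ### The main theorem -/

theorem theorem2p13 {A : Type*} [Order.Frame A] (B : BoundedSublattice A)
    (hB : IsNormalLattice B.Elem) :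
    ∃ g : LocaleMap A (MaxIdeal B.Elem),
      (∀ a : A, LocaleMap.direct g a = wallmanDirect B a) ∧
      ∃ h : LocaleMap (StoneCechLocale A) (MaxIdeal B.Elem),
        LocaleMap.compose h (StoneCechLocale.unit A) = g ∧
        (∀ h' : LocaleMap (StoneCechLocale A) (MaxIdeal B.Elem),
          LocaleMap.compose h' (StoneCechLocale.unit A) = g → h' = h) ∧
        (IsConjunctiveLattice B.Elem →
          (LocaleMap.IsIso h ↔
            Set.InjOn (LocaleMap.direct (StoneCechLocale.unit A)) B.carrier ∧
            IsConjunctiveBase (LocaleMap.direct (StoneCechLocale.unit A) '' B.carrier))) ∧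
        (IsCompletelyRegularLocale A → IsConjunctiveLattice B.Elem → B.IsBase →
          (LocaleMap.IsIso h ↔
            IsConjunctiveBase (LocaleMap.direct (StoneCechLocale.unit A) '' B.carrier))) ∧
        (B.IsBase → B.IsConjunctiveIn →
          IsCompletelyRegularLocale A ∧ IsConjunctiveLattice B.Elem ∧
          (LocaleMap.IsIso h ↔
            IsConjunctiveBase (LocaleMap.direct (StoneCechLocale.unit A) '' B.carrier))) := by
  have part1 : IsConjunctiveLattice B.Elem →
      (LocaleMap.IsIso (BoundedSublattice.comparison hB) ↔
        Set.InjOn (LocaleMap.direct (StoneCechLocale.unit A)) B.carrier ∧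
        IsConjunctiveBase (LocaleMap.direct (StoneCechLocale.unit A) '' B.carrier)) := by
    intro hconj
    rw [StoneCechLocale.direct_unit]
    exact ⟨BoundedSublattice.isConjunctiveBase_of_isIso hB hconj,
      fun h => BoundedSublattice.isIso_of_isConjunctiveBase hB h.1 h.2⟩
  have part2 : IsCompletelyRegularLocale A → IsConjunctiveLattice B.Elem →
      (LocaleMap.IsIso (BoundedSublattice.comparison hB) ↔
        IsConjunctiveBase (LocaleMap.direct (StoneCechLocale.unit A) '' B.carrier)) := by
    intro hA hconj
    -- Over a completely regular locale each `a` is the join of `below a`, so injectivity is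
    -- automatic.
    rw [part1 hconj, and_iff_right_iff_imp]
    intro _
    rw [StoneCechLocale.direct_unit]
    exact (StoneCechLocale.below_injective hA).injOn
  refine ⟨LocaleMap.compose (BoundedSublattice.comparison hB) (StoneCechLocale.unit A),
    congrFun (BoundedSublattice.direct_compose_comparison hB), BoundedSublattice.comparison hB,
    rfl, fun h' hh' => BoundedSublattice.eq_comparison hB hh', part1,
    fun hA hconj _ => part2 hA hconj, fun hbase hconj => ?_⟩
  have hA := BoundedSublattice.IsBase.isCompletelyRegularLocale hB hbase hconj
  have hD := hconj.isConjunctiveLattice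
  exact ⟨hA, hD, part2 hA hD⟩
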